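/- Let $X$ be a (real or complex) Banach space. Let $S$ be the set of all strictly increasing sequences $s\colon\mathbb N\to\mathbb N$ and $P$ the set of all bijections $p\colon\mathbb N\to\mathbb N$, both with the subspace topology of $\mathbb N^{\mathbb N}$ (product of discrete spaces). For the family $Fin$ of finite subsets of $\mathbb N$, a sequence $(u_n)$ in $X$ is $Fin$-bounded if there is $M>0$ with $\{n:\|u_n\|>M\}\in Fin$ (that is, $(u_n)$ is bounded). For a series $\sum x_n$ in $X$ put $$E(Fin,(x_n))=\Big\{s\in S:\Big(\sum_{i=1}^n x_{s(i)}\Big)_n\text{ is $Fin$-bounded}\Big\},\qquad F(Fin,(x_n))=\Big\{p\in P:\Big(\sum_{i=1}^n x_{p(i)}\Big)_n\text{ is $Fin$-bounded}\Big\}.$$ Then $X$ contains no copy of $c_0$ (no linear subspace of $X$ is linearly homeomorphic to $c_0$) if and only if for every series $\sum x_n$ in $X$ which is not unconditionally convergent (i.e. which has some non-convergent rearrangement $\sum x_{p(n)}$, $p\in P$) the set $E(Fin,(x_n))$ is meager in $S$ and the set $F(Fin,(x_n))$ is meager in $P$. -/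

import Mathlib

namespace BoundedSeries

/-- The space `S` of all (strictly) increasing sequences of natural numbers, with the topology
inherited from the product `ℕ → ℕ` of discrete spaces. -/
abbrev S : Type := {s : ℕ → ℕ // StrictMono s}

/-- The space `P` of all bijections of the natural numbers, with the topology
inherited from the product `ℕ → ℕ` of discrete spaces. -/
abbrev P : Type := {p : ℕ → ℕ // Function.Bijective p}

/-- The ideal of all finite subsets of the natural numbers. -/
def FinIdeal : Set (Set ℕ) := {A | A.Finite}

/-- The sequence of partial sums: the `n`-th entry is `x 0 + ⋯ + x n`
(that is, the sum of the first `n + 1` terms). -/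
def partialSums {X : Type*} [AddCommMonoid X] (x : ℕ → X) (n : ℕ) : X :=
  ∑ i ∈ Finset.range (n + 1), x i

/-- A sequence `u` in a normed space is `I`-bounded if there is `M > 0` such that
`{n | ‖u n‖ > M}` belongs to `I`. -/
def IdealBounded {X : Type*} [NormedAddCommGroup X] (I : Set (Set ℕ)) (u : ℕ → X) : Prop :=
  ∃ M : ℝ, 0 < M ∧ {n : ℕ | M < ‖u n‖} ∈ I

/-- `E(I, (x_n))`: the increasing `s` whose subseries `∑ x_{s(n)}` has `I`-bounded
partial sums. -/
def E {X : Type*} [NormedAddCommGroup X] (I : Set (Set ℕ)) (x : ℕ → X) : Set S :=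
  {s | IdealBounded I (partialSums fun i => x (s.1 i))}

/-- `F(I, (x_n))`: the bijections `p` whose rearrangement `∑ x_{p(n)}` has `I`-bounded
partial sums. -/
def F {X : Type*} [NormedAddCommGroup X] (I : Set (Set ℕ)) (x : ℕ → X) : Set P :=
  {p | IdealBounded I (partialSums fun i => x (p.1 i))}

/-- The series `∑ x_n` is unconditionally convergent: all its rearrangements converge. -/
def UnconditionallyConvergent {X : Type*} [NormedAddCommGroup X] (x : ℕ → X) : Prop :=
  ∀ p : P, ∃ l : X, Filter.Tendsto (partialSums fun i => x (p.1 i)) Filter.atTop (nhds l)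

open scoped ZeroAtInfty in
/-- `X` contains a copy of `c₀`: some linear subspace of `X` is linearly homeomorphic to the space
`c₀` of scalar null sequences with the supremum norm. -/
def ContainsCopyOfC0 (𝕜 : Type*) [RCLike 𝕜] (X : Type*) [NormedAddCommGroup X]
    [NormedSpace 𝕜 X] : Prop :=
  ∃ Y : Submodule 𝕜 X, Nonempty (C₀(ℕ, 𝕜) ≃L[𝕜] Y)

end BoundedSeries

/-! Both directions turn on series whose finite sums are uniformly bounded. `E` and `F` are
countable unions of closed sets "all partial sums have norm at most `M`". If one of them is not
meager, some such closed set contains a cylinder. Continuing the fixed initial segment by an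
arbitrary finite set and subtracting then bounds every finite sum of the series. A series with
bounded finite sums that is not summable yields `c₀` (Bessaga–Pełczyński): take disjoint blocks of
norm at least `δ` with norming functionals, and let Rosenthal's lemma select blocks on which these
functionals are almost biorthogonal. Conversely, the unit vectors of a copy of `c₀` do not tend to
`0`, yet all their subseries have bounded partial sums. So `E` is all of `S`, which is not meager
because `S` is a Baire space. -/

namespace BoundedSeries

open Filter Topology

/-- Rosenthal's disjointification lemma, for a matrix whose row sums are at most `n * ε`. -/
theorem exists_injective_offDiag_sum_le {ε : ℝ} (n : ℕ) (a : ℕ → ℕ → ℝ)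
    (ha : ∀ i j, 0 ≤ a i j) (hsum : ∀ i (G : Finset ℕ), ∑ j ∈ G, a i j ≤ n * ε) (hε : 0 < ε) :
    ∃ φ : ℕ → ℕ, Function.Injective φ ∧
      ∀ k (G : Finset ℕ), k ∉ G → ∑ j ∈ G, a (φ k) (φ j) ≤ ε := by
  induction n generalizing a with
  | zero =>
    refine ⟨id, Function.injective_id, fun k G _ => ?_⟩
    have := hsum k G
    simp only [Nat.cast_zero, zero_mul] at this
    exact this.trans hε.le
  | succ n ih =>
    -- Pairing splits `ℕ` into infinitely many infinite blocks. Either some block works, or each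
    -- block `p` has a row `m p` with mass above `ε` inside its own block, off the diagonal.
    -- Restricting to these representatives lowers the row bound by `ε`.
    by_cases h : ∃ p, ∀ m (G : Finset ℕ), m ∉ G →
        ∑ j ∈ G, a (Nat.pair p m) (Nat.pair p j) ≤ ε
    · obtain ⟨p, hp⟩ := h
      exact ⟨Nat.pair p, fun i j hij => (Nat.pair_eq_pair.1 hij).2, hp⟩
    · push Not at h
      choose m G hm hG using h
      have hψ : Function.Injective fun p => Nat.pair p (m p) :=
        fun i j hij => (Nat.pair_eq_pair.1 hij).1
      obtain ⟨φ, hφ, h⟩ := ih (fun p q => a (Nat.pair p (m p)) (Nat.pair q (m q)))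
        (fun _ _ => ha _ _) (fun p A => by
          have hp : Function.Injective (Nat.pair p) := fun i j hij => (Nat.pair_eq_pair.1 hij).2
          have hd : Disjoint (A.map ⟨_, hψ⟩) ((G p).map ⟨_, hp⟩) := by
            rw [Finset.disjoint_left]
            intro z hz hz'
            simp only [Finset.mem_map, Function.Embedding.coeFn_mk] at hz hz'
            obtain ⟨q, -, rfl⟩ := hz
            obtain ⟨j, hj, hjq⟩ := hz'
            obtain ⟨rfl, rfl⟩ := Nat.pair_eq_pair.1 hjq
            exact hm _ hj
          have h1 := hsum (Nat.pair p (m p)) (A.map ⟨_, hψ⟩ ∪ (G p).map ⟨_, hp⟩)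
          rw [Finset.sum_union hd, Finset.sum_map, Finset.sum_map] at h1
          simp only [Function.Embedding.coeFn_mk] at h1
          have h2 := hG p
          push_cast at h1
          linarith)
      exact ⟨fun k => Nat.pair (φ k) (m (φ k)), hψ.comp hφ, h⟩

theorem sum_abs_le_of_abs_sum_le {ι : Type*} {r : ι → ℝ} {C : ℝ}
    (h : ∀ A : Finset ι, |∑ i ∈ A, r i| ≤ C) (G : Finset ι) : ∑ i ∈ G, |r i| ≤ 2 * C := by
  classical
  rw [← Finset.sum_filter_add_sum_filter_not G (fun i => 0 ≤ r i)]
  have h1 : ∑ i ∈ G with 0 ≤ r i, |r i| = ∑ i ∈ G with 0 ≤ r i, r i :=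
    Finset.sum_congr rfl fun i hi => abs_of_nonneg (Finset.mem_filter.1 hi).2
  have h2 : ∑ i ∈ G with ¬ 0 ≤ r i, |r i| = -∑ i ∈ G with ¬ 0 ≤ r i, r i := by
    rw [← Finset.sum_neg_distrib]
    exact Finset.sum_congr rfl fun i hi => abs_of_neg (not_le.1 (Finset.mem_filter.1 hi).2)
  rw [h1, h2]
  linarith [(abs_le.1 (h (G.filter fun i => 0 ≤ r i))).2,
    (abs_le.1 (h (G.filter fun i => ¬ 0 ≤ r i))).1]

/-! ### Copies of `c₀` from series with bounded finite sums -/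

section Banach

variable {𝕜 : Type*} [RCLike 𝕜] {X : Type*} [NormedAddCommGroup X] [NormedSpace 𝕜 X]

/-- Splitting by sign costs a factor `2`, for the real and for the imaginary parts separately; hence
`4`. -/
theorem sum_norm_dual_le {ι : Type*} {z : ι → X} {C : ℝ}
    (h : ∀ A : Finset ι, ‖∑ i ∈ A, z i‖ ≤ C) {f : StrongDual 𝕜 X} (hf : ‖f‖ ≤ 1)
    (G : Finset ι) : ∑ i ∈ G, ‖f (z i)‖ ≤ 4 * C := by
  have hfA (A : Finset ι) : ‖f (∑ i ∈ A, z i)‖ ≤ C :=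
    (f.le_of_opNorm_le hf _).trans (by simpa using h A)
  have hre := sum_abs_le_of_abs_sum_le (r := fun i => RCLike.re (f (z i))) (C := C)
    (fun A => by
      rw [← map_sum, ← map_sum]
      exact (RCLike.abs_re_le_norm _).trans (hfA A)) G
  have him := sum_abs_le_of_abs_sum_le (r := fun i => RCLike.im (f (z i))) (C := C)
    (fun A => by
      rw [← map_sum, ← map_sum]
      exact (RCLike.abs_im_le_norm _).trans (hfA A)) G
  calc ∑ i ∈ G, ‖f (z i)‖
      ≤ ∑ i ∈ G, (|RCLike.re (f (z i))| + |RCLike.im (f (z i))|) :=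
        Finset.sum_le_sum fun i _ => (by
          conv_lhs => rw [← RCLike.re_add_im (f (z i))]
          refine (norm_add_le _ _).trans (add_le_add (by rw [RCLike.norm_ofReal]) ?_)
          rw [norm_mul, RCLike.norm_ofReal]
          exact mul_le_of_le_one_right (abs_nonneg _) (by rw [RCLike.norm_I]; split_ifs <;> simp))
    _ ≤ 4 * C := by rw [Finset.sum_add_distrib]; linarith

theorem norm_sum_smul_le {ι : Type*} {z : ι → X} {C : ℝ}
    (h : ∀ A : Finset ι, ‖∑ i ∈ A, z i‖ ≤ C) (a : ι → 𝕜) {r : ℝ} (hr : 0 ≤ r) (G : Finset ι)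
    (ha : ∀ i ∈ G, ‖a i‖ ≤ r) : ‖∑ i ∈ G, a i • z i‖ ≤ 4 * C * r := by
  obtain ⟨f, hf, hfv⟩ := exists_dual_vector'' 𝕜 (∑ i ∈ G, a i • z i)
  have h1 : ‖∑ i ∈ G, a i • z i‖ = ‖f (∑ i ∈ G, a i • z i)‖ := by
    rw [hfv, RCLike.norm_ofReal, abs_norm]
  rw [h1, map_sum]
  calc ‖∑ i ∈ G, f (a i • z i)‖ ≤ ∑ i ∈ G, ‖f (a i • z i)‖ := norm_sum_le _ _
    _ ≤ ∑ i ∈ G, r * ‖f (z i)‖ := Finset.sum_le_sum fun i hi => by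
        rw [map_smul, norm_smul]
        exact mul_le_mul_of_nonneg_right (ha i hi) (norm_nonneg _)
    _ ≤ 4 * C * r := by
        rw [← Finset.mul_sum, mul_comm]
        exact mul_le_mul_of_nonneg_right (sum_norm_dual_le h hf G) hr

open scoped ZeroAtInfty

theorem norm_apply_le_norm (a : C₀(ℕ, 𝕜)) (i : ℕ) : ‖a i‖ ≤ ‖a‖ :=
  a.toBCF.norm_coe_le_norm i

theorem norm_le_of_forall_norm_apply_le (a : C₀(ℕ, 𝕜)) {r : ℝ} (hr : 0 ≤ r)
    (h : ∀ i, ‖a i‖ ≤ r) : ‖a‖ ≤ r :=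
  (BoundedContinuousFunction.norm_le (f := a.toBCF) hr).2 h

theorem tendsto_cofinite_zero (a : C₀(ℕ, 𝕜)) : Tendsto a cofinite (𝓝 0) := by
  rw [← cocompact_eq_cofinite]
  exact a.zero_at_infty'

theorem summable_smul_of_bounded_sums [CompleteSpace X] {z : ℕ → X} {C : ℝ}
    (h : ∀ A : Finset ℕ, ‖∑ i ∈ A, z i‖ ≤ C) (a : C₀(ℕ, 𝕜)) :
    Summable fun i => a i • z i := by
  rw [summable_iff_vanishing_norm]
  intro ε hε
  have hC : 0 ≤ C := (norm_nonneg _).trans (h ∅)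
  -- The `+ 1` covers `C = 0` and makes the final inequality strict.
  have hδ : 0 < ε / (4 * C + 1) := by positivity
  have hfin : {i | ¬ ‖a i‖ < ε / (4 * C + 1)}.Finite := by
    have := (tendsto_cofinite_zero a).eventually (Metric.ball_mem_nhds 0 hδ)
    simpa [Filter.eventually_cofinite] using this
  refine ⟨hfin.toFinset, fun t ht => ?_⟩
  refine (norm_sum_smul_le h a hδ.le t fun i hi => ?_).trans_lt ?_
  · have := Finset.disjoint_left.1 ht hi
    simp only [Set.Finite.mem_toFinset, Set.mem_ofPred_eq, not_not] at this
    exact this.le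
  · rw [← mul_div_assoc, div_lt_iff₀ (by positivity)]
    nlinarith

/-- A sequence with bounded finite sums which admits almost biorthogonal functionals spans
a copy of `c₀`. -/
theorem containsCopyOfC0_of_functionals [CompleteSpace X] {z : ℕ → X} {C δ : ℝ}
    (h : ∀ A : Finset ℕ, ‖∑ i ∈ A, z i‖ ≤ C) (hδ : 0 < δ) (f : ℕ → StrongDual 𝕜 X)
    (hf : ∀ k, ‖f k‖ ≤ 1) (hfz : ∀ k, δ ≤ ‖f k (z k)‖)
    (hoff : ∀ k (G : Finset ℕ), k ∉ G → ∑ j ∈ G, ‖f k (z j)‖ ≤ δ / 2) :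
    ContainsCopyOfC0 𝕜 X := by
  have hs := summable_smul_of_bounded_sums (𝕜 := 𝕜) h
  let T : C₀(ℕ, 𝕜) →ₗ[𝕜] X :=
    { toFun := fun a => ∑' i, a i • z i
      map_add' := fun a b => by
        rw [← (hs a).tsum_add (hs b)]
        simp only [ZeroAtInftyContinuousMap.add_apply, add_smul]
      map_smul' := fun c a => by
        rw [RingHom.id_apply, ← (hs a).tsum_const_smul c]
        simp only [ZeroAtInftyContinuousMap.smul_apply, smul_smul, smul_eq_mul] }
  have hT (a : C₀(ℕ, 𝕜)) : Tendsto (fun G : Finset ℕ => ∑ i ∈ G, a i • z i) atTop (𝓝 (T a)) :=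
    (hs a).hasSum
  have hupper (a : C₀(ℕ, 𝕜)) : ‖T a‖ ≤ 4 * C * ‖a‖ :=
    le_of_tendsto (hT a).norm <| Eventually.of_forall fun G =>
      norm_sum_smul_le h a (norm_nonneg _) G fun i _ => norm_apply_le_norm a i
  have hlower (a : C₀(ℕ, 𝕜)) : ‖a‖ ≤ 2 / δ * ‖T a‖ := by
    -- `f k` sees at least `δ * ‖a k‖` from the `k`-th term and at most `‖a‖ * (δ / 2)` from the
    -- others. The supremum over `k` absorbs the latter.
    have key (k : ℕ) : ‖a k‖ * δ ≤ ‖T a‖ + ‖a‖ * (δ / 2) := by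
      rw [← sub_le_iff_le_add]
      refine ge_of_tendsto (hT a).norm ?_
      filter_upwards [eventually_ge_atTop ({k} : Finset ℕ)] with G hG
      have hk : k ∈ G := hG (Finset.mem_singleton_self k)
      have h1 : ‖f k (∑ i ∈ G, a i • z i)‖ ≤ ‖∑ i ∈ G, a i • z i‖ := by
        simpa using (f k).le_of_opNorm_le (hf k) (∑ i ∈ G, a i • z i)
      refine le_trans ?_ h1
      rw [← Finset.add_sum_erase G _ hk, map_add, map_sum]
      have h2 : ‖∑ i ∈ G.erase k, f k (a i • z i)‖ ≤ ‖a‖ * (δ / 2) :=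
        calc _ ≤ ∑ i ∈ G.erase k, ‖f k (a i • z i)‖ := norm_sum_le _ _
          _ ≤ ∑ i ∈ G.erase k, ‖a‖ * ‖f k (z i)‖ := Finset.sum_le_sum fun i _ => by
              rw [map_smul, norm_smul]
              exact mul_le_mul_of_nonneg_right (norm_apply_le_norm a i) (norm_nonneg _)
          _ ≤ ‖a‖ * (δ / 2) := by
              rw [← Finset.mul_sum]
              exact mul_le_mul_of_nonneg_left (hoff k _ (Finset.notMem_erase k G))
                (norm_nonneg _)
      have h3 : ‖a k‖ * δ ≤ ‖f k (a k • z k)‖ := by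
        rw [map_smul, norm_smul]
        exact mul_le_mul_of_nonneg_left (hfz k) (norm_nonneg _)
      have h4 := norm_sub_le_norm_add (f k (a k • z k)) (∑ i ∈ G.erase k, f k (a i • z i))
      linarith
    have h5 : ‖a‖ ≤ (‖T a‖ + ‖a‖ * (δ / 2)) / δ :=
      norm_le_of_forall_norm_apply_le a (by positivity) fun k =>
        (le_div_iff₀ hδ).2 (key k)
    rw [le_div_iff₀ hδ] at h5
    rw [div_mul_eq_mul_div, le_div_iff₀ hδ]
    linarith
  have hinj : Function.Injective T := by
    rw [injective_iff_map_eq_zero]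
    intro a ha
    have := hlower a
    rw [ha, norm_zero, mul_zero] at this
    exact norm_le_zero_iff.1 this
  let e := LinearEquiv.ofInjective T hinj
  refine ⟨T.range, ⟨{ e with continuous_toFun := ?_, continuous_invFun := ?_ }⟩⟩
  · exact AddMonoidHomClass.continuous_of_bound e (4 * C) hupper
  · refine AddMonoidHomClass.continuous_of_bound e.symm (2 / δ) fun y => ?_
    obtain ⟨a, rfl⟩ := e.surjective y
    rw [e.symm_apply_apply]
    exact hlower a

/-- Bessaga–Pełczyński: a non-summable series with bounded finite sums yields a copy
of `c₀`. -/
theorem containsCopyOfC0_of_not_summable [CompleteSpace X] {x : ℕ → X} {C : ℝ}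
    (h : ∀ A : Finset ℕ, ‖∑ i ∈ A, x i‖ ≤ C) (hx : ¬ Summable x) : ContainsCopyOfC0 𝕜 X := by
  classical
  rw [summable_iff_vanishing_norm] at hx
  push Not at hx
  obtain ⟨δ, hδ, hx⟩ := hx
  obtain ⟨t, ht, htd⟩ := exists_seq_of_forall_finset_exists
    (fun t : Finset ℕ => δ ≤ ‖∑ i ∈ t, x i‖) (fun s t => Disjoint s t) (fun s _ => by
      obtain ⟨t, htd, ht⟩ := hx (s.biUnion id)
      exact ⟨t, ht, fun u hu => ((Finset.disjoint_biUnion_right _ _ _).1 htd u hu).symm⟩)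
  have htd' : Pairwise fun m n => Disjoint (t m) (t n) := fun m n hmn =>
    hmn.lt_or_gt.elim (htd m n) fun h => (htd n m h).symm
  let y : ℕ → X := fun k => ∑ i ∈ t k, x i
  choose f hf hfy using fun k => exists_dual_vector'' 𝕜 (y k)
  have hy {φ : ℕ → ℕ} (hφ : Function.Injective φ) (A : Finset ℕ) :
      ‖∑ k ∈ A, y (φ k)‖ ≤ C := by
    rw [← Finset.sum_biUnion fun i _ j _ hij => htd' (hφ.ne hij)]
    exact h _
  -- Row sums are at most `4 * C`, so this `n` fits Rosenthal's lemma with `ε = δ / 2`.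
  obtain ⟨n, hn⟩ := exists_nat_ge (4 * C / (δ / 2))
  rw [div_le_iff₀ (half_pos hδ)] at hn
  obtain ⟨φ, hφ, hoff⟩ := exists_injective_offDiag_sum_le n (fun k j => ‖f k (y j)‖)
    (fun _ _ => norm_nonneg _)
    (fun k G => (sum_norm_dual_le (hy Function.injective_id) (hf k) G).trans hn) (half_pos hδ)
  refine containsCopyOfC0_of_functionals (z := fun k => y (φ k)) (hy hφ) hδ
    (fun k => f (φ k)) (fun k => hf _) (fun k => ?_) hoff
  rw [hfy, RCLike.norm_ofReal, abs_norm]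
  exact ht _

end Banach

end BoundedSeries
namespace BoundedSeries

open Filter Topology

/-! ### Baire category in `S` and `P` -/

section Category

variable {X : Type*} [NormedAddCommGroup X]

theorem unconditionallyConvergent_of_summable {x : ℕ → X} (hx : Summable x) :
    UnconditionallyConvergent x := fun p => by
  obtain ⟨l, hl⟩ := hx
  have := (Equiv.ofBijective p.1 p.2).hasSum_iff.2 hl
  exact ⟨l, (this.tendsto_sum_nat.comp (tendsto_add_atTop_nat 1))⟩

theorem idealBounded_finIdeal_iff {u : ℕ → X} :
    IdealBounded FinIdeal u ↔ ∃ M : ℕ, ∀ n, ‖u n‖ ≤ M := by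
  constructor
  · rintro ⟨M, -, hM⟩
    obtain ⟨K, hK⟩ := (hM.image fun n => ‖u n‖).bddAbove
    obtain ⟨N, hN⟩ := exists_nat_ge (max M K)
    refine ⟨N, fun n => le_trans ?_ hN⟩
    by_cases hn : M < ‖u n‖
    · exact (hK ⟨n, hn, rfl⟩).trans (le_max_right _ _)
    · exact (not_lt.1 hn).trans (le_max_left _ _)
  · rintro ⟨M, hM⟩
    refine ⟨M + 1, by positivity, ?_⟩
    have : {n : ℕ | (M : ℝ) + 1 < ‖u n‖} = ∅ :=
      Set.eq_empty_of_forall_notMem fun n (hn : (M : ℝ) + 1 < ‖u n‖) => by linarith [hM n]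
    rw [this]
    exact Set.finite_empty

theorem exists_interior_nonempty_of_not_isMeagre {T : Type*} [TopologicalSpace T]
    {g : T → ℕ → X} (hg : ∀ n, Continuous fun t => g t n)
    (h : ¬ IsMeagre {t | IdealBounded FinIdeal (g t)}) :
    ∃ M : ℕ, (interior {t | ∀ n, ‖g t n‖ ≤ M}).Nonempty := by
  by_contra! hM
  refine h (IsMeagre.mono (s := ⋃ M : ℕ, {t | ∀ n, ‖g t n‖ ≤ M}) (fun t ht => ?_)
    (isMeagre_iUnion fun M => ?_))
  · exact Set.mem_iUnion.2 (idealBounded_finIdeal_iff.1 ht)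
  · refine IsNowhereDense.isMeagre ?_
    have : IsClosed {t | ∀ n, ‖g t n‖ ≤ M} := by
      rw [Set.ofPred_forall]
      exact isClosed_iInter fun n => isClosed_le (hg n).norm continuous_const
    rw [this.isNowhereDense_iff]
    exact hM M

/-- A neighbourhood in a subspace of `ℕ → ℕ` contains a cylinder. -/
theorem exists_cylinder_subset {Q : (ℕ → ℕ) → Prop} {U : Set {s : ℕ → ℕ // Q s}} (s : {s // Q s})
    (hs : s ∈ interior U) : ∃ k, ∀ q : {s // Q s}, (∀ i < k, q.1 i = s.1 i) → q ∈ U := by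
  obtain ⟨V, hV, hVU⟩ := isOpen_induced_iff.1 (isOpen_interior (s := U))
  have hsV : s.1 ∈ V := by rw [← hVU] at hs; exact hs
  obtain ⟨I, u, hu, hI⟩ := isOpen_pi_iff.1 hV s.1 hsV
  refine ⟨I.sup id + 1, fun q hq => interior_subset ?_⟩
  rw [← hVU]
  refine hI fun i hi => ?_
  rw [hq i (Nat.lt_succ_of_le (Finset.le_sup (f := id) hi))]
  exact (hu i hi).2

theorem continuous_partialSums_apply {Q : (ℕ → ℕ) → Prop} (x : ℕ → X) (n : ℕ) :
    Continuous fun s : {s : ℕ → ℕ // Q s} => partialSums (fun i => x (s.1 i)) n :=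
  continuous_finsetSum _ fun i _ =>
    (continuous_of_discreteTopology (f := x)).comp
      ((continuous_apply i).comp continuous_subtype_val)

theorem norm_sum_range_le_of_partialSums {u : ℕ → X} {M : ℝ} (hM : 0 ≤ M)
    (h : ∀ n, ‖partialSums u n‖ ≤ M) (n : ℕ) : ‖∑ i ∈ Finset.range n, u i‖ ≤ M := by
  cases n with
  | zero => simpa using hM
  | succ n => exact h n

theorem exists_bound_of_tail_bound {x : ℕ → X} {C : ℝ} (N : ℕ)
    (h : ∀ B : Finset ℕ, (∀ b ∈ B, N ≤ b) → ‖∑ i ∈ B, x i‖ ≤ C) :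
    ∃ K, ∀ A : Finset ℕ, ‖∑ i ∈ A, x i‖ ≤ K := by
  refine ⟨∑ i ∈ Finset.range N, ‖x i‖ + C, fun A => ?_⟩
  rw [← Finset.sum_filter_add_sum_filter_not A (fun i => i < N)]
  refine (norm_add_le _ _).trans (add_le_add ((norm_sum_le _ _).trans ?_) (h _ fun b hb => ?_))
  · refine Finset.sum_le_sum_of_subset_of_nonneg (fun i hi => ?_) fun _ _ _ => norm_nonneg _
    exact Finset.mem_range.2 (Finset.mem_filter.1 hi).2
  · exact not_lt.1 (Finset.mem_filter.1 hb).2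

/-- An initial segment of an increasing sequence can be continued by any finite set
lying above it. -/
theorem exists_strictMono_image_eq {s : ℕ → ℕ} (hs : StrictMono s) (k : ℕ) (B : Finset ℕ)
    (hB : ∀ b ∈ B, s k ≤ b) : ∃ q : ℕ → ℕ, StrictMono q ∧ (∀ i < k, q i = s i) ∧
      (Finset.range (k + B.card)).image q = (Finset.range k).image s ∪ B := by
  induction B using Finset.induction_on_max with
  | empty => exact ⟨s, hs, fun _ _ => rfl, by simp⟩
  | insert b B hb ih =>
    obtain ⟨q, hq, hqs, hqB⟩ := ih fun c hc => hB c (Finset.mem_insert_of_mem hc)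
    have hlt (i : ℕ) (hi : i < k + B.card) : q i < b := by
      have := Finset.mem_image_of_mem q (Finset.mem_range.2 hi)
      rw [hqB, Finset.mem_union, Finset.mem_image] at this
      obtain ⟨j, hj, hji⟩ | h := this
      · rw [← hji]
        exact (hs (Finset.mem_range.1 hj)).trans_le (hB b (Finset.mem_insert_self b B))
      · exact hb _ h
    have hbB : b ∉ B := fun h => (hb b h).false
    -- All earlier values lie below `b`, so the sequence may go on with `b, b + 1, …`.
    refine ⟨fun i => if i < k + B.card then q i else b + (i - (k + B.card)),
      strictMono_nat_of_lt_succ fun i => ?_, fun i hi => ?_, ?_⟩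
    · have h1 := hlt i
      have h2 := hq (Nat.lt_succ_self i)
      split_ifs <;> omega
    · simp only [if_pos (show i < k + B.card by omega), hqs i hi]
    · rw [Finset.card_insert_of_notMem hbB, ← add_assoc, Finset.range_add_one,
        Finset.image_insert, Finset.union_insert, ← hqB]
      congr 1
      · simp
      · exact Finset.image_congr fun i hi => if_pos (Finset.mem_range.1 hi)

/-- Each new element of `B` is brought to the next free position by a swap that touches no earlier
position. Composing a bijection with `σ` preserves its first `k` values. -/
theorem exists_perm_image_eq (k : ℕ) (B : Finset ℕ) (hB : ∀ b ∈ B, k ≤ b) :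
    ∃ σ : Equiv.Perm ℕ, (∀ i < k, σ i = i) ∧
      (Finset.range (k + B.card)).image σ = Finset.range k ∪ B := by
  induction B using Finset.induction_on with
  | empty => exact ⟨1, fun _ _ => rfl, by simp⟩
  | insert b B hb ih =>
    obtain ⟨σ, hσ, hσB⟩ := ih fun c hc => hB c (Finset.mem_insert_of_mem hc)
    have hbk := hB b (Finset.mem_insert_self b B)
    have hne (i : ℕ) (hi : i < k + B.card) : i ≠ σ.symm b := by
      rintro rfl
      have := Finset.mem_image_of_mem σ (Finset.mem_range.2 hi)
      rw [hσB, σ.apply_symm_apply, Finset.mem_union, Finset.mem_range] at this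
      exact this.elim (fun h => absurd h (not_lt.2 hbk)) hb
    have heq (i : ℕ) (hi : i < k + B.card) :
        (σ * Equiv.swap (k + B.card) (σ.symm b)) i = σ i := by
      rw [Equiv.Perm.mul_apply, Equiv.swap_apply_of_ne_of_ne hi.ne (hne i hi)]
    refine ⟨σ * Equiv.swap (k + B.card) (σ.symm b), fun i hi => ?_, ?_⟩
    · rw [heq i (by omega), hσ i hi]
    · rw [Finset.card_insert_of_notMem hb, ← add_assoc, Finset.range_add_one,
        Finset.image_insert, Finset.union_insert, ← hσB]
      congr 1
      · simp
      · exact Finset.image_congr fun i hi => heq i (Finset.mem_range.1 hi)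

/-- The sum over a finite set `B` far out is the difference of two partial sums, of `q` and of `s`,
both indexed by points of one cylinder; hence the bound `M + M`. -/
theorem exists_bound_of_not_isMeagre_E {x : ℕ → X} (h : ¬ IsMeagre (E FinIdeal x)) :
    ∃ K, ∀ A : Finset ℕ, ‖∑ i ∈ A, x i‖ ≤ K := by
  obtain ⟨M, s, hs⟩ := exists_interior_nonempty_of_not_isMeagre
    (continuous_partialSums_apply (Q := StrictMono) x) h
  obtain ⟨k, hk⟩ := exists_cylinder_subset s hs
  have hM : (0 : ℝ) ≤ M := M.cast_nonneg
  refine exists_bound_of_tail_bound (C := M + M) (s.1 k) fun B hB => ?_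
  obtain ⟨q, hq, hqs, hqB⟩ := exists_strictMono_image_eq s.2 k B hB
  have h1 := norm_sum_range_le_of_partialSums hM (hk ⟨q, hq⟩ hqs) (k + B.card)
  have h2 := norm_sum_range_le_of_partialSums hM (hk s fun _ _ => rfl) k
  have hd : Disjoint ((Finset.range k).image s.1) B := by
    rw [Finset.disjoint_left]
    intro z hz hzB
    obtain ⟨i, hi, rfl⟩ := Finset.mem_image.1 hz
    exact absurd (s.2 (Finset.mem_range.1 hi)) (not_lt.2 (hB _ hzB))
  rw [← Finset.sum_image (f := x) (g := q) hq.injective.injOn, hqB, Finset.sum_union hd,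
    Finset.sum_image s.2.injective.injOn] at h1
  rw [← add_sub_cancel_left (∑ i ∈ Finset.range k, x (s.1 i)) (∑ i ∈ B, x i)]
  exact (norm_sub_le _ _).trans (add_le_add h1 h2)

theorem exists_bound_of_not_isMeagre_F {x : ℕ → X} (h : ¬ IsMeagre (F FinIdeal x)) :
    ∃ K, ∀ A : Finset ℕ, ‖∑ i ∈ A, x i‖ ≤ K := by
  obtain ⟨M, p, hp⟩ := exists_interior_nonempty_of_not_isMeagre
    (continuous_partialSums_apply (Q := Function.Bijective) x) h
  obtain ⟨k, hk⟩ := exists_cylinder_subset p hp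
  have hM : (0 : ℝ) ≤ M := M.cast_nonneg
  obtain ⟨K, hK⟩ := exists_bound_of_tail_bound (x := fun i => x (p.1 i)) (C := M + M) k
    fun B hB => by
      obtain ⟨σ, hσ, hσB⟩ := exists_perm_image_eq k B hB
      have h1 := norm_sum_range_le_of_partialSums hM
        (hk ⟨p.1 ∘ σ, p.2.comp σ.bijective⟩ fun i hi => congrArg p.1 (hσ i hi)) (k + B.card)
      have h2 := norm_sum_range_le_of_partialSums hM (hk p fun _ _ => rfl) k
      have hd : Disjoint (Finset.range k) B := by
        rw [Finset.disjoint_left]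
        exact fun z hz hzB => absurd (Finset.mem_range.1 hz) (not_lt.2 (hB z hzB))
      simp only [Function.comp_apply] at h1
      rw [← Finset.sum_image (f := fun i => x (p.1 i)) (g := σ) σ.injective.injOn, hσB,
        Finset.sum_union hd] at h1
      rw [← add_sub_cancel_left (∑ i ∈ Finset.range k, x (p.1 i)) (∑ i ∈ B, x (p.1 i))]
      exact (norm_sub_le _ _).trans (add_le_add h1 h2)
  refine ⟨K, fun A => ?_⟩
  -- `K` bounds the finite sums of the rearranged series; `e.symm` carries this back to `x`.
  let e := Equiv.ofBijective p.1 p.2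
  have := hK (A.map e.symm.toEmbedding)
  rw [Finset.sum_map] at this
  have he (i : ℕ) : p.1 (e.symm i) = i := e.apply_symm_apply i
  simpa only [Equiv.coe_toEmbedding, he] using this

end Category

/-- Strict monotonicity is a condition on consecutive coordinates, so `S` is closed in the Polish
space `ℕ → ℕ`. -/
instance : BaireSpace S := by
  have : IsClosed {s : ℕ → ℕ | StrictMono s} := by
    have : {s : ℕ → ℕ | StrictMono s} = ⋂ n, {s | s n < s (n + 1)} := by
      ext s
      simp only [Set.mem_ofPred_eq, Set.mem_iInter]
      exact ⟨fun h n => h n.lt_succ_self, strictMono_nat_of_lt_succ⟩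
    rw [this]
    refine isClosed_iInter fun n => ?_
    have hc : Continuous fun s : ℕ → ℕ => (s n, s (n + 1)) :=
      (continuous_apply n).prodMk (continuous_apply (n + 1))
    exact (isClosed_discrete {z : ℕ × ℕ | z.1 < z.2}).preimage hc
  have := this.polishSpace
  exact inferInstanceAs (BaireSpace {s : ℕ → ℕ | StrictMono s})

/-! ### The unit vectors of `c₀` -/

section UnitVectors

open scoped ZeroAtInfty

variable (𝕜 : Type*) [RCLike 𝕜]

/-- The indicator function of a finite set, as an element of `c₀`. -/
def indicatorC0 (A : Finset ℕ) : C₀(ℕ, 𝕜) where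
  toFun i := if i ∈ A then 1 else 0
  continuous_toFun := continuous_of_discreteTopology
  zero_at_infty' := by
    rw [cocompact_eq_cofinite]
    refine tendsto_const_nhds.congr' ?_
    filter_upwards [A.finite_toSet.compl_mem_cofinite] with i hi
    exact (if_neg hi).symm

theorem indicatorC0_apply (A : Finset ℕ) (i : ℕ) :
    indicatorC0 𝕜 A i = if i ∈ A then 1 else 0 := rfl

theorem norm_indicatorC0_le (A : Finset ℕ) : ‖indicatorC0 𝕜 A‖ ≤ 1 :=
  norm_le_of_forall_norm_apply_le _ zero_le_one fun i => by
    rw [indicatorC0_apply]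
    split_ifs <;> simp

theorem sum_indicatorC0_singleton (A : Finset ℕ) :
    ∑ i ∈ A, indicatorC0 𝕜 {i} = indicatorC0 𝕜 A := by
  induction A using Finset.induction_on with
  | empty => ext i; simp [indicatorC0_apply]
  | insert a A ha ih =>
    rw [Finset.sum_insert ha, ih]
    ext i
    rw [ZeroAtInftyContinuousMap.add_apply]
    simp only [indicatorC0_apply, Finset.mem_insert, Finset.mem_singleton]
    by_cases h : i = a
    · subst h; simp [ha]
    · simp [h]

variable {𝕜} {X : Type*} [NormedAddCommGroup X] [NormedSpace 𝕜 X]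

/-- A sum of distinct unit vectors is an indicator, of norm at most `1`, so `‖T‖` bounds the partial
sums. -/
theorem idealBounded_partialSums_of_injective (T : C₀(ℕ, 𝕜) →L[𝕜] X) {s : ℕ → ℕ}
    (hs : Function.Injective s) :
    IdealBounded FinIdeal (partialSums fun i => T (indicatorC0 𝕜 {s i})) := by
  obtain ⟨M, hM⟩ := exists_nat_ge ‖T‖
  refine idealBounded_finIdeal_iff.2 ⟨M, fun n => ?_⟩
  rw [partialSums, ← map_sum,
    ← Finset.sum_image (f := fun j => indicatorC0 𝕜 {j}) hs.injOn, sum_indicatorC0_singleton]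
  exact ((T.le_opNorm_of_le (norm_indicatorC0_le 𝕜 _)).trans (by rw [mul_one])).trans hM

theorem tendsto_zero_of_unconditionallyConvergent {x : ℕ → X}
    (hx : UnconditionallyConvergent x) : Tendsto x atTop (𝓝 0) := by
  obtain ⟨l, hl⟩ := hx ⟨id, Function.bijective_id⟩
  have h := (hl.comp (tendsto_add_atTop_nat 1)).sub hl
  rw [sub_self] at h
  rw [← tendsto_add_atTop_iff_nat 1]
  refine h.congr fun n => ?_
  simp [partialSums, Finset.sum_range_succ _ (n + 1)]

theorem not_unconditionallyConvergent_unitVectors {Y : Submodule 𝕜 X}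
    (e : C₀(ℕ, 𝕜) ≃L[𝕜] Y) :
    ¬ UnconditionallyConvergent fun n => (e (indicatorC0 𝕜 {n}) : X) := fun h => by
  have h1 := tendsto_zero_of_unconditionallyConvergent h
  have h2 : Tendsto (fun n => e (indicatorC0 𝕜 {n})) atTop (𝓝 0) :=
    tendsto_subtype_rng.2 h1
  have h3 := ((e.symm.continuous.tendsto 0).comp h2).norm
  simp only [Function.comp_def, e.symm_apply_apply, map_zero, norm_zero] at h3
  obtain ⟨n, hn⟩ := (h3.eventually (gt_mem_nhds one_pos)).exists
  have h4 := norm_apply_le_norm (indicatorC0 𝕜 {n}) n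
  rw [indicatorC0_apply, if_pos (Finset.mem_singleton_self n), norm_one] at h4
  exact (h4.trans_lt hn).false

end UnitVectors

end BoundedSeries

theorem mainTheorem2 (𝕜 : Type*) [RCLike 𝕜] (X : Type*) [NormedAddCommGroup X]
    [NormedSpace 𝕜 X] [CompleteSpace X] :
    ¬ BoundedSeries.ContainsCopyOfC0 𝕜 X ↔
      ∀ x : ℕ → X, ¬ BoundedSeries.UnconditionallyConvergent x →
        IsMeagre (BoundedSeries.E BoundedSeries.FinIdeal x) ∧
        IsMeagre (BoundedSeries.F BoundedSeries.FinIdeal x) := by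
  open BoundedSeries in
  constructor
  · intro hX x hx
    have hsum : ¬ Summable x := fun h => hx (unconditionallyConvergent_of_summable h)
    constructor
    · by_contra h
      obtain ⟨K, hK⟩ := exists_bound_of_not_isMeagre_E h
      exact hX (containsCopyOfC0_of_not_summable hK hsum)
    · by_contra h
      obtain ⟨K, hK⟩ := exists_bound_of_not_isMeagre_F h
      exact hX (containsCopyOfC0_of_not_summable hK hsum)
  · rintro h ⟨Y, ⟨e⟩⟩
    -- Meagerness of `E` alone already gives the contradiction.
    obtain ⟨hE, -⟩ := h _ (not_unconditionallyConvergent_unitVectors e)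
    have huniv : E FinIdeal (fun n => (e (indicatorC0 𝕜 {n}) : X)) = Set.univ :=
      Set.eq_univ_of_forall fun s => idealBounded_partialSums_of_injective
        (Y.subtypeL.comp e.toContinuousLinearMap) s.2.injective
    rw [huniv] at hE
    exact not_isMeagre_of_isOpen isOpen_univ ⟨⟨id, strictMono_id⟩, trivial⟩ hE
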